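/- Let $\mu=p_1\delta_{M_1}+\cdots+p_N\delta_{M_N}$ be a probability distribution on $\mathbb{R}^{n\times n}$, where $p_1,\dots,p_N>0$ and $M_1,\dots,M_N\in\mathbb{R}^{n\times n}$. Let $\mathcal M=\operatorname{supp}\mu$ and let $A$ be a random matrix with law $\mu$. Write $$\hat\rho(\mathcal M)=\limsup_{k\to\infty}\ \sup_{A_1,\dots,A_k\in\mathcal M}\|A_k\cdots A_1\|^{1/k}$$ for the joint spectral radius of $\mathcal M$ (with $\|\cdot\|$ the maximal singular value), $\rho(B)$ for the spectral radius of a real square matrix $B$ (the largest modulus of its complex eigenvalues), and $A^{\otimes p}$ for the $p$-fold Kronecker power of $A$, i.e. $A^{\otimes 1}=A$ and $A^{\otimes p}=A^{\otimes(p-1)}\otimes A$. Then $\hat\rho(\mathcal M)$ is finite and $$\hat\rho(\mathcal M)=\lim_{p\to\infty}\rho\bigl(E[A^{\otimes(2p)}]\bigr)^{1/(2p)}=\limsup_{p\to\infty}\rho\bigl(E[A^{\otimes p}]\bigr)^{1/p},$$ where $p$ runs over the positive integers; in particular the limit exists. -/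

import Mathlib

open MeasureTheory ProbabilityTheory Filter
open scoped ENNReal

noncomputable section

/-- Matrices carry the entrywise product `σ`-algebra. -/
instance instMeasurableSpaceRealMatrix {m n : Type*} : MeasurableSpace (Matrix m n ℝ) :=
  inferInstanceAs (MeasurableSpace (m → n → ℝ))

/-- For countable index types this is the Borel `σ`-algebra. -/
instance instBorelSpaceRealMatrix {m n : Type*} [Countable m] [Countable n] :
    BorelSpace (Matrix m n ℝ) :=
  inferInstanceAs (BorelSpace (m → n → ℝ))

open scoped Matrix.Norms.L2Operator in
/-- The joint spectral radius `limsup_{k → ∞} sup_{A₁, …, A_k ∈ S} ‖A_k ⋯ A₁‖ ^ (1 / k)` of a set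
`S` of real `n × n` matrices, as an extended nonnegative real number. The norm is the maximal
singular value (the `ℓ²` operator norm). The supremum runs over all `k`-tuples in `S`, so the order
in which a tuple is multiplied does not matter. -/
def jointSpectralRadius {n : ℕ} (S : Set (Matrix (Fin n) (Fin n) ℝ)) : ℝ≥0∞ :=
  limsup (fun k : ℕ => ⨆ A : Fin k → S,
    ‖(List.ofFn fun i => (A i : Matrix (Fin n) (Fin n) ℝ)).prod‖ₑ ^ (1 / (k : ℝ))) atTop

/-- The Kronecker power `A^{⊗p}`, an `n^p × n^p` matrix, with `A^{⊗(p+1)} = A^{⊗p} ⊗ A`. The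
recursion starts at `A^{⊗0} = 1` (a `1 × 1` matrix), so that `A^{⊗1} = 1 ⊗ A = A`. -/
def kroneckerPower {n : ℕ} (A : Matrix (Fin n) (Fin n) ℝ) :
    (p : ℕ) → Matrix (Fin (n ^ p)) (Fin (n ^ p)) ℝ
  | 0 => 1
  | p + 1 => Matrix.reindex finProdFinEquiv finProdFinEquiv
      (Matrix.kronecker (kroneckerPower A p) A)

/-- The (entrywise) expectation `E[A^{⊗p}]` of the Kronecker power of a random matrix `A`. -/
def expectedKroneckerPower {n : ℕ} {Ω : Type*} [MeasurableSpace Ω] (P : Measure Ω)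
    (A : Ω → Matrix (Fin n) (Fin n) ℝ) (p : ℕ) : Matrix (Fin (n ^ p)) (Fin (n ^ p)) ℝ :=
  Matrix.of fun i j => ∫ ω, kroneckerPower (A ω) p i j ∂P

/-- The spectral radius of a real square matrix: the largest modulus of its complex eigenvalues. -/
def matrixSpectralRadius {m : ℕ} (B : Matrix (Fin m) (Fin m) ℝ) : ℝ≥0∞ :=
  spectralRadius ℂ (B.map (algebraMap ℝ ℂ))

end

/-!
Since `(A * B)^{⊗p} = A^{⊗p} * B^{⊗p}`, the `k`-th power of `E[A^{⊗p}] = ∑ i, w i • M i^{⊗p}` is the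
weighted sum of the `p`-th Kronecker powers of all products of `k` of the matrices `M i`. By
Gelfand's formula `ρ(E[A^{⊗p}])` is the growth rate of the norms of these powers, and in finite
dimension norms may be replaced by largest entries, as constants independent of `k` do not matter.

The entries of `Q^{⊗p}` are products of `p` entries of `Q`, so `ρ(E[A^{⊗p}]) ≤ C * J ^ p`, where `J`
is the joint spectral radius and `C = ∑ i, w i`. Conversely, the entry of `Q^{⊗p}` at the
multi-indices `(i, …, i)` and `(j, …, j)` is `Q i j ^ p`, which is nonnegative for even `p`. Hence
nothing cancels in the weighted sum, each of its terms is a lower bound, and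
`J ^ p ≤ D * ρ(E[A^{⊗p}])` with `D = ∑ i, (w i)⁻¹`. Neither `C` nor `D` depends on `p`, so they
disappear on taking `p`-th roots.
-/

section GrowthRate

open ExpGrowth

/-- The exponential growth rate `limsup_{k → ∞} u_k ^ (1 / k)` of a sequence: the exponential of
`ExpGrowth.expGrowthSup u`, on the multiplicative scale on which spectral radii live. -/
noncomputable def growthRate (u : ℕ → ℝ≥0∞) : ℝ≥0∞ :=
  limsup (fun k : ℕ => u k ^ (1 / (k : ℝ))) atTop

variable {u v a : ℕ → ℝ≥0∞} {C D J : ℝ≥0∞}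

theorem exp_log_div_natCast (x : ℝ≥0∞) (k : ℕ) :
    EReal.exp (ENNReal.log x / k) = x ^ (1 / (k : ℝ)) := by
  rw [ENNReal.rpow_eq_exp_mul_log, mul_comm, one_div, EReal.coe_inv, div_eq_mul_inv]
  rfl

theorem growthRate_eq_exp_expGrowthSup (u : ℕ → ℝ≥0∞) :
    growthRate u = EReal.exp (expGrowthSup u) := by
  simp only [growthRate, ← exp_log_div_natCast]
  exact (EReal.expOrderIso.limsup_apply (u := fun k : ℕ => ENNReal.log (u k) / k)).symm

theorem growthRate_le_of_eventually_le_const_mul (hC : C ≠ ∞)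
    (h : ∀ᶠ k in atTop, u k ≤ C * v k) : growthRate u ≤ growthRate v := by
  simp only [growthRate_eq_exp_expGrowthSup]
  exact EReal.exp_monotone (expGrowthSup_le_of_eventually_le hC h)

theorem growthRate_geometric (J : ℝ≥0∞) : growthRate (fun k => J ^ k) = J := by
  rw [growthRate_eq_exp_expGrowthSup, expGrowthSup_pow, ENNReal.exp_log]

theorem growthRate_geometric_mul (hC : C ≠ ∞) (u : ℕ → ℝ≥0∞) :
    growthRate (fun k => C ^ k * u k) = C * growthRate u := by
  rw [growthRate, growthRate, ← ENNReal.limsup_const_mul_of_ne_top hC]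
  refine limsup_congr ((eventually_ne_atTop 0).mono fun k hk => ?_)
  rw [ENNReal.mul_rpow_of_nonneg _ _ (by positivity), one_div, ENNReal.pow_rpow_inv_natCast hk]

theorem growthRate_pow (u : ℕ → ℝ≥0∞) (p : ℕ) :
    growthRate (fun k => u k ^ p) = growthRate u ^ p := by
  have h := (pow_left_mono (M := ℝ≥0∞) p).map_limsup_of_continuousAt
    (fun k : ℕ => u k ^ (1 / (k : ℝ))) (ENNReal.continuous_pow p).continuousAt (F := atTop)
  rw [growthRate, growthRate, h]
  congr 1 with k
  simp only [Function.comp_apply, ← ENNReal.rpow_natCast, ← ENNReal.rpow_mul, mul_comm]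

theorem tendsto_rpow_one_div_of_geometric_bounds (hC : C ≠ ∞) (hD : D ≠ ∞)
    (hle : ∀ᶠ k in atTop, a k ≤ C * J ^ k) (hge : ∀ᶠ k in atTop, J ^ k ≤ D * a k) :
    Tendsto (fun k : ℕ => a k ^ (1 / (k : ℝ))) atTop (nhds J) := by
  have hlog : Tendsto (fun k : ℕ => ENNReal.log (a k) / k) atTop (nhds (ENNReal.log J)) :=
    tendsto_of_le_liminf_of_limsup_le
      (expGrowthInf_pow (b := J) ▸ expGrowthInf_le_of_eventually_le hD hge)
      (expGrowthSup_pow (b := J) ▸ expGrowthSup_le_of_eventually_le hC hle)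
  simpa only [Function.comp_def, exp_log_div_natCast, ENNReal.exp_log] using
    (ENNReal.continuous_exp.tendsto _).comp hlog

theorem tendsto_even_rpow_one_div_of_geometric_bounds (hC : C ≠ ∞) (hD : D ≠ ∞)
    (hle : ∀ p, a p ≤ C * J ^ p) (hge : ∀ p, p ≠ 0 → Even p → J ^ p ≤ D * a p) :
    Tendsto (fun p : ℕ => a (2 * p) ^ (1 / (2 * (p : ℝ)))) atTop (nhds J) := by
  have hsq : Tendsto (fun p : ℕ => a (2 * p) ^ (1 / (p : ℝ))) atTop (nhds (J ^ 2)) := by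
    refine tendsto_rpow_one_div_of_geometric_bounds hC hD (.of_forall fun p => ?_)
      ((eventually_ne_atTop 0).mono fun p hp => ?_)
    · simpa only [pow_mul] using hle (2 * p)
    · simpa only [pow_mul] using hge (2 * p) (by positivity) (even_two_mul p)
  have hsqrt := hsq.ennrpow_const (((2 : ℕ) : ℝ)⁻¹)
  rw [ENNReal.pow_rpow_inv_natCast two_ne_zero] at hsqrt
  refine hsqrt.congr fun p => ?_
  rw [← ENNReal.rpow_mul, Nat.cast_two, one_div, one_div, mul_inv_rev]

theorem growthRate_eq_of_geometric_bounds (hC : C ≠ ∞) (hD : D ≠ ∞)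
    (hle : ∀ p, a p ≤ C * J ^ p) (hge : ∀ p, p ≠ 0 → Even p → J ^ p ≤ D * a p) :
    growthRate a = J := by
  apply le_antisymm
  · simpa only [growthRate_geometric] using
      growthRate_le_of_eventually_le_const_mul hC (.of_forall hle)
  · have heven := tendsto_even_rpow_one_div_of_geometric_bounds hC hD hle hge
    have hdouble : Tendsto (fun p : ℕ => 2 * p) atTop atTop :=
      tendsto_id.const_mul_atTop' two_pos
    calc J = limsup ((fun m : ℕ => a m ^ (1 / (m : ℝ))) ∘ (2 * ·)) atTop := by
          simpa [Function.comp_def] using heven.limsup_eq.symm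
      _ ≤ growthRate a := by
          rw [limsup_comp]
          exact limsup_le_limsup_of_le hdouble

end GrowthRate

section MatrixNorms

open scoped Matrix.Norms.L2Operator

variable {𝕜 m n : Type*} [RCLike 𝕜] [Fintype m] [Fintype n] [DecidableEq n]

theorem enorm_entry_le_l2_opENorm (A : Matrix m n 𝕜) (i : m) (j : n) : ‖A i j‖ₑ ≤ ‖A‖ₑ := by
  rw [enorm_le_iff_norm_le]
  calc ‖A i j‖ = ‖WithLp.toLp 2 (A.mulVec (Pi.single j 1)) i‖ := by simp
    _ ≤ ‖WithLp.toLp 2 (A.mulVec (Pi.single j 1))‖ := PiLp.norm_apply_le _ i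
    _ ≤ ‖A‖ * ‖EuclideanSpace.single j (1 : 𝕜)‖ := A.l2_opNorm_mulVec (.single j 1)
    _ = ‖A‖ := by rw [PiLp.norm_single, norm_one, mul_one]

theorem l2_opENorm_single_one [DecidableEq m] (i : m) (j : n) :
    ‖(Matrix.single i j 1 : Matrix m n 𝕜)‖ₑ = 1 := by
  have hsq : ‖(Matrix.single i j 1 : Matrix m n 𝕜)‖ ^ 2 = 1 :=
    calc ‖(Matrix.single i j 1 : Matrix m n 𝕜)‖ ^ 2
        = ‖(Matrix.single j j 1 : Matrix n n 𝕜)‖ := by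
          rw [sq, ← Matrix.l2_opNorm_conjTranspose_mul_self, Matrix.conjTranspose_single, star_one,
            Matrix.single_mul_single_same, one_mul]
      _ = 1 := by
          rw [← Matrix.diagonal_single, Matrix.l2_opNorm_diagonal, Pi.norm_single, norm_one]
  rw [← ofReal_norm, (pow_eq_one_iff_of_nonneg (norm_nonneg _) two_ne_zero).1 hsq,
    ENNReal.ofReal_one]

theorem l2_opENorm_le_of_enorm_entry_le (A : Matrix m n 𝕜) {c : ℝ≥0∞}
    (h : ∀ i j, ‖A i j‖ₑ ≤ c) : ‖A‖ₑ ≤ Fintype.card m * Fintype.card n * c := by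
  classical
  have hsingle (i : m) (j : n) : ‖Matrix.single i j (A i j)‖ₑ ≤ c := by
    rw [← mul_one (A i j), ← smul_eq_mul, ← Matrix.smul_single, enorm_smul,
      l2_opENorm_single_one, mul_one]
    exact h i j
  calc ‖A‖ₑ = ‖∑ i, ∑ j, Matrix.single i j (A i j)‖ₑ := by rw [← Matrix.matrix_eq_sum_single]
    _ ≤ ∑ i, ∑ j, ‖Matrix.single i j (A i j)‖ₑ :=
        (enorm_sum_le _ _).trans (Finset.sum_le_sum fun i _ => enorm_sum_le _ _)
    _ ≤ ∑ _i : m, ∑ _j : n, c := by gcongr; exact hsingle _ _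
    _ = Fintype.card m * Fintype.card n * c := by simp [mul_assoc]

theorem l2_opENorm_pow_le_of_enorm_entry_pow_le (A : Matrix m n 𝕜) {c : ℝ≥0∞} {p : ℕ} (hp : p ≠ 0)
    (h : ∀ i j, ‖A i j‖ₑ ^ p ≤ c) : ‖A‖ₑ ^ p ≤ (Fintype.card m * Fintype.card n) ^ p * c := by
  have hroot : ∀ i j, ‖A i j‖ₑ ≤ c ^ (p⁻¹ : ℝ) := fun i j => by
    rw [← ENNReal.pow_rpow_inv_natCast hp ‖A i j‖ₑ]
    exact ENNReal.rpow_le_rpow (h i j) (by positivity)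
  calc ‖A‖ₑ ^ p ≤ (Fintype.card m * Fintype.card n * c ^ (p⁻¹ : ℝ)) ^ p := by
        gcongr; exact l2_opENorm_le_of_enorm_entry_le A hroot
    _ = _ := by rw [mul_pow, ENNReal.rpow_inv_natCast_pow hp]

end MatrixNorms

section JointSpectralRadius

/-- The largest norm of a product of `k` factors taken from `S`: the sequence whose growth rate is
the joint spectral radius. -/
noncomputable def maxProdNorm {R : Type*} [SeminormedRing R] (S : Set R) (k : ℕ) : ℝ≥0∞ :=
  ⨆ A : Fin k → S, ‖(List.ofFn fun t => (A t : R)).prod‖ₑ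

section SeminormedRing

variable {R : Type*} [SeminormedRing R] {S : Set R}

theorem nnnorm_list_prod_le_pow_length {l : List R} (hl : l ≠ []) {C : NNReal}
    (h : ∀ x ∈ l, ‖x‖₊ ≤ C) : ‖l.prod‖₊ ≤ C ^ l.length := by
  calc ‖l.prod‖₊ ≤ (l.map nnnorm).prod := List.nnnorm_prod_le' hl
    _ ≤ C ^ (l.map nnnorm).length := List.prod_le_pow_card _ C (List.forall_mem_map.2 h)
    _ = C ^ l.length := by rw [List.length_map]

theorem enorm_prod_ofFn_le_maxProdNorm {k : ℕ} (A : Fin k → R) (hA : ∀ t, A t ∈ S) :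
    ‖(List.ofFn A).prod‖ₑ ≤ maxProdNorm S k :=
  le_iSup (fun A : Fin k → S => ‖(List.ofFn fun t => (A t : R)).prod‖ₑ) fun t => ⟨A t, hA t⟩

theorem maxProdNorm_le_pow {C : NNReal} (h : ∀ x ∈ S, ‖x‖₊ ≤ C) {k : ℕ} (hk : k ≠ 0) :
    maxProdNorm S k ≤ (C : ℝ≥0∞) ^ k := by
  refine iSup_le fun A => ?_
  have hbound : ‖(List.ofFn fun t => (A t : R)).prod‖₊ ≤ C ^ k := by
    simpa only [List.length_ofFn] using nnnorm_list_prod_le_pow_length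
      (l := List.ofFn fun t => (A t : R)) (by simpa using hk)
      (List.forall_mem_ofFn_iff.2 fun t => h _ (A t).2)
  exact_mod_cast hbound

theorem growthRate_maxProdNorm_ne_top (hS : Bornology.IsBounded S) :
    growthRate (maxProdNorm S) ≠ ∞ := by
  obtain ⟨C, hC⟩ := hS.exists_norm_le
  have hbound : ∀ x ∈ S, ‖x‖₊ ≤ C.toNNReal := fun x hx => by
    rw [← norm_toNNReal]
    exact Real.toNNReal_mono (hC x hx)
  have hgrowth : growthRate (maxProdNorm S) ≤ growthRate fun k => (C.toNNReal : ℝ≥0∞) ^ k :=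
    growthRate_le_of_eventually_le_const_mul ENNReal.one_ne_top
      ((eventually_ne_atTop 0).mono fun k hk =>
        (maxProdNorm_le_pow hbound hk).trans_eq (one_mul _).symm)
  rw [growthRate_geometric] at hgrowth
  exact ne_top_of_le_ne_top ENNReal.coe_ne_top hgrowth

end SeminormedRing

open scoped Matrix.Norms.L2Operator

variable {n : ℕ} {S : Set (Matrix (Fin n) (Fin n) ℝ)}

theorem jointSpectralRadius_eq_growthRate (S : Set (Matrix (Fin n) (Fin n) ℝ)) :
    jointSpectralRadius S = growthRate (maxProdNorm S) := by
  refine limsup_congr ((eventually_gt_atTop 0).mono fun k hk => ?_)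
  exact ((ENNReal.orderIsoRpow (1 / (k : ℝ)) (by positivity)).map_iSup fun A : Fin k → S =>
    ‖(List.ofFn fun t => (A t : Matrix (Fin n) (Fin n) ℝ)).prod‖ₑ).symm

theorem jointSpectralRadius_ne_top_of_finite (hS : S.Finite) : jointSpectralRadius S ≠ ∞ := by
  rw [jointSpectralRadius_eq_growthRate]
  exact growthRate_maxProdNorm_ne_top hS.isBounded

end JointSpectralRadius

section SpectralRadius

open scoped Matrix.Norms.L2Operator

theorem matrixSpectralRadius_eq_growthRate {m : ℕ} (B : Matrix (Fin m) (Fin m) ℝ) :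
    matrixSpectralRadius B = growthRate fun k => ‖B ^ k‖ₑ := by
  have : CompleteSpace (Matrix (Fin m) (Fin m) ℂ) := FiniteDimensional.complete ℂ _
  have hgelfand : matrixSpectralRadius B =
      growthRate fun k => ‖(B.map (algebraMap ℝ ℂ)) ^ k‖ₑ :=
    (spectrum.pow_nnnorm_pow_one_div_tendsto_nhds_spectralRadius
      (B.map (algebraMap ℝ ℂ))).limsup_eq.symm
  have hentry (k : ℕ) (i j : Fin m) :
      ‖((B.map (algebraMap ℝ ℂ)) ^ k) i j‖ₑ = ‖(B ^ k) i j‖ₑ := by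
    rw [← Matrix.map_pow, Matrix.map_apply, ← ofReal_norm, norm_algebraMap', ofReal_norm]
  have hcard : (Fintype.card (Fin m) * Fintype.card (Fin m) : ℝ≥0∞) ≠ ∞ := by finiteness
  rw [hgelfand]
  apply le_antisymm <;>
    refine growthRate_le_of_eventually_le_const_mul hcard
      (.of_forall fun k => l2_opENorm_le_of_enorm_entry_le _ fun i j => ?_)
  · exact (hentry k i j).trans_le (enorm_entry_le_l2_opENorm _ i j)
  · exact (hentry k i j).symm.trans_le (enorm_entry_le_l2_opENorm _ i j)

end SpectralRadius

section KroneckerPower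

variable {n : ℕ}

theorem kroneckerPower_succ_apply (A : Matrix (Fin n) (Fin n) ℝ) (p : ℕ)
    (i j : Fin (n ^ (p + 1))) :
    kroneckerPower A (p + 1) i j =
      kroneckerPower A p (finProdFinEquiv.symm i).1 (finProdFinEquiv.symm j).1 *
        A (finProdFinEquiv.symm i).2 (finProdFinEquiv.symm j).2 := rfl

theorem kroneckerPower_one (p : ℕ) :
    kroneckerPower (1 : Matrix (Fin n) (Fin n) ℝ) p = 1 := by
  induction p with
  | zero => rfl
  | succ p ih =>
    rw [kroneckerPower, ih, Matrix.kronecker, Matrix.one_kronecker_one]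
    exact Matrix.submatrix_one_equiv _

theorem kroneckerPower_mul (A B : Matrix (Fin n) (Fin n) ℝ) (p : ℕ) :
    kroneckerPower (A * B) p = kroneckerPower A p * kroneckerPower B p := by
  induction p with
  | zero => exact (one_mul _).symm
  | succ p ih =>
    simp only [kroneckerPower, ih, Matrix.kronecker, Matrix.mul_kronecker_mul,
      Matrix.reindex_apply]
    exact (Matrix.submatrix_mul_equiv _ _ _ _ _).symm

theorem kroneckerPower_list_prod (l : List (Matrix (Fin n) (Fin n) ℝ)) (p : ℕ) :
    kroneckerPower l.prod p = (l.map fun A => kroneckerPower A p).prod :=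
  map_list_prod (⟨⟨fun A => kroneckerPower A p, kroneckerPower_one p⟩,
    fun A B => kroneckerPower_mul A B p⟩ :
      Matrix (Fin n) (Fin n) ℝ →* Matrix (Fin (n ^ p)) (Fin (n ^ p)) ℝ) l

theorem enorm_kroneckerPower_apply_le {A : Matrix (Fin n) (Fin n) ℝ} {c : ℝ≥0∞}
    (hA : ∀ i j, ‖A i j‖ₑ ≤ c) (p : ℕ) (i j : Fin (n ^ p)) :
    ‖kroneckerPower A p i j‖ₑ ≤ c ^ p := by
  induction p with
  | zero =>
    rw [kroneckerPower, Matrix.one_apply]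
    split_ifs <;> simp
  | succ p ih =>
    rw [kroneckerPower_succ_apply, enorm_mul, pow_succ]
    exact mul_le_mul' (ih _ _) (hA _ _)

/-- The multi-index `(i, …, i)` as a row or column index of the `p`-fold Kronecker power: these
indices carry the `p`-th powers of the entries of the matrix. -/
def kroneckerDiagIndex (i : Fin n) : (p : ℕ) → Fin (n ^ p)
  | 0 => ⟨0, by simp⟩
  | p + 1 => finProdFinEquiv (kroneckerDiagIndex i p, i)

theorem kroneckerPower_kroneckerDiagIndex (A : Matrix (Fin n) (Fin n) ℝ) (i j : Fin n) (p : ℕ) :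
    kroneckerPower A p (kroneckerDiagIndex i p) (kroneckerDiagIndex j p) = A i j ^ p := by
  induction p with
  | zero => exact (Matrix.one_apply_eq _).trans (pow_zero _).symm
  | succ p ih =>
    rw [kroneckerPower_succ_apply, pow_succ]
    simp only [kroneckerDiagIndex, Equiv.symm_apply_apply, ih]

theorem continuous_kroneckerPower_apply (p : ℕ) (i j : Fin (n ^ p)) :
    Continuous fun A : Matrix (Fin n) (Fin n) ℝ => kroneckerPower A p i j := by
  induction p with
  | zero => exact continuous_const
  | succ p ih =>
    simp only [kroneckerPower_succ_apply]
    exact (ih _ _).mul (continuous_id.matrix_elem _ _)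

end KroneckerPower

section WeightedSums

theorem enorm_finsetProd {ι R : Type*} [SeminormedCommRing R] [NormMulClass R] [NormOneClass R]
    (s : Finset ι) (x : ι → R) :
    ‖∏ i ∈ s, x i‖ₑ = ∏ i ∈ s, ‖x i‖ₑ := by
  simp only [enorm, nnnorm_prod, ENNReal.ofNNReal_finsetProd]

theorem sum_smul_pow {R 𝒜 ι : Type*} [CommSemiring R] [Semiring 𝒜] [Algebra R 𝒜] [Fintype ι]
    (w : ι → R) (x : ι → 𝒜) (k : ℕ) :
    (∑ i, w i • x i) ^ k =
      ∑ f : Fin k → ι, (∏ t, w (f t)) • (List.ofFn fun t => x (f t)).prod := by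
  classical
  calc (∑ i, w i • x i) ^ k
      = MultilinearMap.mkPiAlgebraFin R k 𝒜 fun _ => ∑ i, w i • x i := by
        rw [MultilinearMap.mkPiAlgebraFin_apply, List.ofFn_const, List.prod_replicate]
    _ = ∑ f : Fin k → ι, MultilinearMap.mkPiAlgebraFin R k 𝒜 fun t => w (f t) • x (f t) :=
        MultilinearMap.map_sum _ _
    _ = _ := by simp only [MultilinearMap.map_smul_univ, MultilinearMap.mkPiAlgebraFin_apply]

open scoped Matrix.Norms.L2Operator

variable {n : ℕ} {ι : Type*} [Fintype ι] {w : ι → ℝ}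

theorem sum_smul_kroneckerPower_pow_apply (w : ι → ℝ) (M : ι → Matrix (Fin n) (Fin n) ℝ)
    (p k : ℕ) (i j : Fin (n ^ p)) :
    ((∑ i, w i • kroneckerPower (M i) p) ^ k) i j = ∑ f : Fin k → ι, (∏ t, w (f t)) *
      kroneckerPower (List.ofFn fun t => M (f t)).prod p i j := by
  simp only [sum_smul_pow, kroneckerPower_list_prod, List.map_ofFn, Function.comp_def,
    Matrix.sum_apply, Matrix.smul_apply, smul_eq_mul]

theorem enorm_sum_smul_kroneckerPower_pow_apply_le (w : ι → ℝ)
    (M : ι → Matrix (Fin n) (Fin n) ℝ) (p k : ℕ) (i j : Fin (n ^ p)) :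
    ‖((∑ i, w i • kroneckerPower (M i) p) ^ k) i j‖ₑ ≤
      (∑ i, ‖w i‖ₑ) ^ k * maxProdNorm (Set.range M) k ^ p := by
  rw [sum_smul_kroneckerPower_pow_apply]
  calc ‖∑ f : Fin k → ι, (∏ t, w (f t)) * kroneckerPower (List.ofFn fun t => M (f t)).prod p i j‖ₑ
      ≤ ∑ f : Fin k → ι, (∏ t, ‖w (f t)‖ₑ) * maxProdNorm (Set.range M) k ^ p := by
        refine (enorm_sum_le _ _).trans (Finset.sum_le_sum fun f _ => ?_)
        rw [enorm_mul, enorm_finsetProd]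
        gcongr
        exact enorm_kroneckerPower_apply_le (fun a b => (enorm_entry_le_l2_opENorm _ a b).trans
          (enorm_prod_ofFn_le_maxProdNorm _ fun t => Set.mem_range_self (f t))) p i j
    _ = _ := by rw [← Finset.sum_mul, ← Fintype.sum_pow fun i => ‖w i‖ₑ]

theorem matrixSpectralRadius_sum_smul_kroneckerPower_le (w : ι → ℝ)
    (M : ι → Matrix (Fin n) (Fin n) ℝ) (p : ℕ) :
    matrixSpectralRadius (∑ i, w i • kroneckerPower (M i) p) ≤
      (∑ i, ‖w i‖ₑ) * jointSpectralRadius (Set.range M) ^ p := by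
  rw [matrixSpectralRadius_eq_growthRate, jointSpectralRadius_eq_growthRate, ← growthRate_pow,
    ← growthRate_geometric_mul (ENNReal.sum_ne_top.2 fun i _ => enorm_ne_top)]
  exact growthRate_le_of_eventually_le_const_mul (by finiteness) (.of_forall fun k =>
    l2_opENorm_le_of_enorm_entry_le _ (enorm_sum_smul_kroneckerPower_pow_apply_le w M p k))

theorem prod_mul_entry_pow_le_sum_smul_kroneckerPower_pow (hw : ∀ i, 0 ≤ w i)
    (M : ι → Matrix (Fin n) (Fin n) ℝ) {p : ℕ} (hp : Even p) {k : ℕ} (f : Fin k → ι)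
    (i j : Fin n) :
    (∏ t, w (f t)) * (List.ofFn fun t => M (f t)).prod i j ^ p ≤
      ((∑ i, w i • kroneckerPower (M i) p) ^ k)
        (kroneckerDiagIndex i p) (kroneckerDiagIndex j p) := by
  simp only [sum_smul_kroneckerPower_pow_apply, kroneckerPower_kroneckerDiagIndex]
  exact Finset.single_le_sum
    (f := fun g : Fin k → ι => (∏ t, w (g t)) * (List.ofFn fun t => M (g t)).prod i j ^ p)
    (fun g _ => mul_nonneg (Finset.prod_nonneg fun t _ => hw _) (hp.pow_nonneg _))
    (Finset.mem_univ f)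

theorem enorm_entry_pow_le_enorm_sum_smul_kroneckerPower_pow (hw : ∀ i, 0 < w i)
    (M : ι → Matrix (Fin n) (Fin n) ℝ) {p : ℕ} (hp : Even p) {k : ℕ} (f : Fin k → ι)
    (i j : Fin n) :
    ‖(List.ofFn fun t => M (f t)).prod i j‖ₑ ^ p ≤
      (∑ i, ‖w i‖ₑ⁻¹) ^ k * ‖(∑ i, w i • kroneckerPower (M i) p) ^ k‖ₑ := by
  set Q := (List.ofFn fun t => M (f t)).prod
  set B := ∑ i, w i • kroneckerPower (M i) p
  have hone (a : ι) : 1 ≤ (∑ i, ‖w i‖ₑ⁻¹) * ‖w a‖ₑ := by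
    rw [← ENNReal.inv_mul_cancel (enorm_ne_zero.2 (hw a).ne') enorm_ne_top]
    gcongr
    exact Finset.single_le_sum_of_canonicallyOrdered (f := fun i => ‖w i‖ₑ⁻¹)
      (Finset.mem_univ a)
  have hweights : 1 ≤ (∑ i, ‖w i‖ₑ⁻¹) ^ k * ‖∏ t, w (f t)‖ₑ := by
    simpa [enorm_finsetProd, Finset.prod_mul_distrib] using
      Finset.one_le_prod' (s := Finset.univ) fun t _ => hone (f t)
  have hentry : ‖(∏ t, w (f t)) * Q i j ^ p‖ₑ ≤ ‖B ^ k‖ₑ := by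
    refine le_trans ?_ (enorm_entry_le_l2_opENorm _ (kroneckerDiagIndex i p)
      (kroneckerDiagIndex j p))
    rw [enorm_le_iff_norm_le]
    exact abs_le_abs_of_nonneg
      (mul_nonneg (Finset.prod_nonneg fun t _ => (hw _).le) (hp.pow_nonneg _))
      (prod_mul_entry_pow_le_sum_smul_kroneckerPower_pow (fun i => (hw i).le) M hp f i j)
  calc ‖Q i j‖ₑ ^ p ≤ (∑ i, ‖w i‖ₑ⁻¹) ^ k * ‖∏ t, w (f t)‖ₑ * ‖Q i j‖ₑ ^ p :=
        le_mul_of_one_le_left' hweights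
    _ = (∑ i, ‖w i‖ₑ⁻¹) ^ k * ‖(∏ t, w (f t)) * Q i j ^ p‖ₑ := by
        rw [enorm_mul, enorm_pow, mul_assoc]
    _ ≤ _ := by gcongr

theorem maxProdNorm_range_pow_le (hw : ∀ i, 0 < w i) (M : ι → Matrix (Fin n) (Fin n) ℝ) {p : ℕ}
    (hp0 : p ≠ 0) (hp : Even p) (k : ℕ) :
    maxProdNorm (Set.range M) k ^ p ≤ (n * n) ^ p *
      ((∑ i, ‖w i‖ₑ⁻¹) ^ k * ‖(∑ i, w i • kroneckerPower (M i) p) ^ k‖ₑ) := by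
  rw [maxProdNorm, ENNReal.iSup_pow_of_ne_zero hp0]
  refine iSup_le fun A => ?_
  choose f hf using fun t => (A t).2
  simpa only [hf, Fintype.card_fin] using l2_opENorm_pow_le_of_enorm_entry_pow_le _ hp0
    (enorm_entry_pow_le_enorm_sum_smul_kroneckerPower_pow hw M hp f)

theorem jointSpectralRadius_pow_le (hw : ∀ i, 0 < w i) (M : ι → Matrix (Fin n) (Fin n) ℝ) {p : ℕ}
    (hp0 : p ≠ 0) (hp : Even p) :
    jointSpectralRadius (Set.range M) ^ p ≤
      (∑ i, ‖w i‖ₑ⁻¹) * matrixSpectralRadius (∑ i, w i • kroneckerPower (M i) p) := by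
  have hD : ∑ i, ‖w i‖ₑ⁻¹ ≠ ∞ :=
    ENNReal.sum_ne_top.2 fun i _ => ENNReal.inv_ne_top.2 (enorm_ne_zero.2 (hw i).ne')
  rw [matrixSpectralRadius_eq_growthRate, jointSpectralRadius_eq_growthRate, ← growthRate_pow,
    ← growthRate_geometric_mul hD]
  exact growthRate_le_of_eventually_le_const_mul (by finiteness)
    (.of_forall (maxProdNorm_range_pow_le hw M hp0 hp))

end WeightedSums

section AtomicMeasures

variable {ι : Type*} [Fintype ι]

theorem support_sum_smul_dirac {X : Type*} [TopologicalSpace X] [T1Space X] [MeasurableSpace X]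
    [OpensMeasurableSpace X] {c : ι → ℝ≥0∞} (hc : ∀ i, c i ≠ 0) (x : ι → X) :
    (∑ i, c i • Measure.dirac (x i)).support = Set.range x := by
  have hclosed : IsClosed (Set.range x) := (Set.finite_range x).isClosed
  apply Set.Subset.antisymm
  · refine Measure.support_subset_of_isClosed hclosed ?_
    rw [mem_ae_iff]
    simp [Measure.dirac_apply' _ hclosed.measurableSet.compl]
  · rintro _ ⟨i, rfl⟩
    refine (Measure.mem_support_iff_forall _).2 fun U hU => ?_
    calc 0 < c i := pos_iff_ne_zero.2 (hc i)
      _ = (c i • Measure.dirac (x i)) U := by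
          rw [Measure.smul_apply, Measure.dirac_apply_of_mem (mem_of_mem_nhds hU), smul_eq_mul,
            mul_one]
      _ ≤ (∑ i, c i • Measure.dirac (x i)) U := by
          rw [Measure.finsetSum_apply]
          exact Finset.single_le_sum_of_canonicallyOrdered
            (f := fun i => (c i • Measure.dirac (x i)) U) (Finset.mem_univ i)

theorem integral_sum_smul_dirac {X E : Type*} [MeasurableSpace X] [NormedAddCommGroup E]
    [NormedSpace ℝ E] [CompleteSpace E] {w : ι → ℝ} (hw : ∀ i, 0 ≤ w i) (x : ι → X) {g : X → E}
    (hg : StronglyMeasurable g) :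
    ∫ y, g y ∂(∑ i, ENNReal.ofReal (w i) • Measure.dirac (x i)) = ∑ i, w i • g (x i) := by
  rw [integral_finsetSum_measure fun i _ =>
    (integrable_dirac' hg enorm_lt_top).smul_measure ENNReal.ofReal_ne_top]
  exact Finset.sum_congr rfl fun i _ => by
    rw [integral_smul_measure, integral_dirac' _ _ hg, ENNReal.toReal_ofReal (hw i)]

theorem expectedKroneckerPower_eq_sum {n : ℕ} {w : ι → ℝ} (hw : ∀ i, 0 ≤ w i)
    {M : ι → Matrix (Fin n) (Fin n) ℝ} {Ω : Type*} [MeasurableSpace Ω] {P : Measure Ω}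
    {A : Ω → Matrix (Fin n) (Fin n) ℝ}
    (hA : HasLaw A (∑ i, ENNReal.ofReal (w i) • Measure.dirac (M i)) P) (p : ℕ) :
    expectedKroneckerPower P A p = ∑ i, w i • kroneckerPower (M i) p := by
  ext a b
  have hg := (continuous_kroneckerPower_apply (n := n) p a b).measurable
  calc expectedKroneckerPower P A p a b
      = ∫ B, kroneckerPower B p a b ∂(∑ i, ENNReal.ofReal (w i) • Measure.dirac (M i)) :=
        hA.integral_comp (f := fun B => kroneckerPower B p a b) hg.aestronglyMeasurable
    _ = ∑ i, w i • kroneckerPower (M i) p a b := integral_sum_smul_dirac hw M hg.stronglyMeasurable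
    _ = _ := by simp only [Matrix.sum_apply, Matrix.smul_apply]

end AtomicMeasures

theorem mainTheorem3_general {n : ℕ} {ι : Type*} [Fintype ι]
    (μ : Measure (Matrix (Fin n) (Fin n) ℝ))
    (w : ι → ℝ) (hw : ∀ i, 0 < w i) (M : ι → Matrix (Fin n) (Fin n) ℝ)
    (hμ : μ = ∑ i, ENNReal.ofReal (w i) • Measure.dirac (M i))
    {Ω : Type*} [MeasurableSpace Ω] (P : Measure Ω)
    (A : Ω → Matrix (Fin n) (Fin n) ℝ) (hA : HasLaw A μ P) :
    jointSpectralRadius μ.support ≠ ∞ ∧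
    Tendsto (fun p : ℕ =>
        matrixSpectralRadius (expectedKroneckerPower P A (2 * p)) ^ (1 / (2 * (p : ℝ))))
      atTop (nhds (jointSpectralRadius μ.support)) ∧
    limsup (fun p : ℕ =>
        matrixSpectralRadius (expectedKroneckerPower P A p) ^ (1 / (p : ℝ))) atTop
      = jointSpectralRadius μ.support := by
  subst hμ
  have hC : ∑ i, ‖w i‖ₑ ≠ ∞ := ENNReal.sum_ne_top.2 fun i _ => enorm_ne_top
  have hD : ∑ i, ‖w i‖ₑ⁻¹ ≠ ∞ :=
    ENNReal.sum_ne_top.2 fun i _ => ENNReal.inv_ne_top.2 (enorm_ne_zero.2 (hw i).ne')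
  have hle := matrixSpectralRadius_sum_smul_kroneckerPower_le w M
  have hge (p : ℕ) := jointSpectralRadius_pow_le hw M (p := p)
  simp only [support_sum_smul_dirac fun i => (ENNReal.ofReal_pos.2 (hw i)).ne',
    expectedKroneckerPower_eq_sum (fun i => (hw i).le) hA]
  exact ⟨jointSpectralRadius_ne_top_of_finite (Set.finite_range M),
    tendsto_even_rpow_one_div_of_geometric_bounds hC hD hle hge,
    growthRate_eq_of_geometric_bounds hC hD hle hge⟩

theorem mainTheorem3 {n : ℕ}
    (μ : Measure (Matrix (Fin n) (Fin n) ℝ)) [IsProbabilityMeasure μ]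
    {N : ℕ} (w : Fin N → ℝ) (hw : ∀ i, 0 < w i) (M : Fin N → Matrix (Fin n) (Fin n) ℝ)
    (hμ : μ = ∑ i, ENNReal.ofReal (w i) • Measure.dirac (M i))
    {Ω : Type*} [MeasurableSpace Ω] (P : Measure Ω) [IsProbabilityMeasure P]
    (A : Ω → Matrix (Fin n) (Fin n) ℝ) (hA : HasLaw A μ P) :
    jointSpectralRadius μ.support ≠ ∞ ∧
    Tendsto (fun p : ℕ =>
        matrixSpectralRadius (expectedKroneckerPower P A (2 * p)) ^ (1 / (2 * (p : ℝ))))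
      atTop (nhds (jointSpectralRadius μ.support)) ∧
    limsup (fun p : ℕ =>
        matrixSpectralRadius (expectedKroneckerPower P A p) ^ (1 / (p : ℝ))) atTop
      = jointSpectralRadius μ.support :=
  mainTheorem3_general μ w hw M hμ P A hA
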